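/- Let $a,b,q\in\mathbb{C}$ with $|q|<1$, let $(x;p)_\infty=\prod_{k\ge 0}(1-xp^k)$ and $(x,y;p)_\infty=(x;p)_\infty(y;p)_\infty$, and consider the continued fraction $$ 1-ab+\cfrac{(a-bq)(b-aq)}{(1-ab)(1+q^2)+\cfrac{(a-bq^3)(b-aq^3)}{(1-ab)(1+q^4)+\cfrac{(a-bq^5)(b-aq^5)}{(1-ab)(1+q^6)+\cdots}}} $$ with $n$-th partial numerator $(a-bq^{2n-1})(b-aq^{2n-1})$ and $n$-th partial denominator $(1-ab)(1+q^{2n})$, $n\ge1$. Convergence of a continued fraction means convergence of its approximants in $\hat{\mathbb{C}}=\mathbb{C}\cup\{\infty\}$, the approximants being evaluated in $\hat{\mathbb{C}}$; if some partial numerator vanishes, the continued fraction is understood to terminate just before the first such numerator. If $|ab|<1$, the continued fraction converges to $$ \frac{(a^2q,b^2q;q^4)_\infty}{(a^2q^3,b^2q^3;q^4)_\infty}, $$ and if $|ab|>1$, it converges to $$ -ab\,\frac{(q/a^2,q/b^2;q^4)_\infty}{(q^3/a^2,q^3/b^2;q^4)_\infty}. $$ In each case the numerator and the denominator of the quotient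 of infinite products do not both vanish, and the value is $\infty$ when the denominator vanishes. -/

import Mathlib

open Filter Topology

/-- The infinite `q`-shifted factorial `(x; q)_∞ = ∏_{k ≥ 0} (1 - x q ^ k)`. -/
noncomputable def qPochInf (x q : ℂ) : ℂ := ∏' k : ℕ, (1 - x * q ^ k)

/-- For `|q| < 1` the product defining `(x; q)_∞` converges absolutely. -/
theorem multipliable_qPochInf (x : ℂ) {q : ℂ} (hq : ‖q‖ < 1) :
    Multipliable (fun k : ℕ => 1 - x * q ^ k) := by
  have h : Summable (fun k : ℕ => ‖-(x * q ^ k)‖) := by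
    simp only [norm_neg, norm_mul, norm_pow]
    exact (summable_geometric_of_lt_one (norm_nonneg q) hq).mul_left ‖x‖
  simpa [sub_eq_add_neg] using multipliable_one_add_of_summable h

/-- The quotient `x / y` in the extended complex plane `ℂ ∪ {∞}`, for `x`, `y` not both zero. -/
noncomputable def extDiv (x y : ℂ) : OnePoint ℂ :=
  open Classical in if y = 0 then OnePoint.infty else ((x / y : ℂ) : OnePoint ℂ)

/-- The Möbius map `w ↦ α / (β + w)` of `ℂ ∪ {∞}`. A vanishing partial numerator `α = 0` stands
for termination of the continued fraction: the map is then constantly `0`. -/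
noncomputable def cfStep (α β : ℂ) (w : OnePoint ℂ) : OnePoint ℂ :=
  open Classical in
  if α = 0 then ((0 : ℂ) : OnePoint ℂ)
  else w.elim ((0 : ℂ) : OnePoint ℂ) (fun z : ℂ => extDiv α (β + z))

/-- The map `S_n` of the continued fraction `b₀ + K (α_k / β_k)`, where `α 0, β 0` are the *first*
partial numerator and denominator: `S_0 (w) = b₀ + w`, `S_{n+1} (w) = S_n (s_{n+1} (w))`. -/
noncomputable def cfMap (b₀ : ℂ) (α β : ℕ → ℂ) : ℕ → OnePoint ℂ → OnePoint ℂ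
  | 0, w => OnePoint.map (fun z : ℂ => b₀ + z) w
  | n + 1, w => cfMap b₀ α β n (cfStep (α n) (β n) w)

/-- The `n`-th approximant `S_n (0)`
`= b₀ + α 0 / (β 0 + α 1 / (β 1 + ⋯ + α (n - 1) / β (n - 1)))`. -/
noncomputable def cfApproximant (b₀ : ℂ) (α β : ℕ → ℂ) (n : ℕ) : OnePoint ℂ :=
  cfMap b₀ α β n ((0 : ℂ) : OnePoint ℂ)

/-- The continued fraction `b₀ + K (α_k / β_k)` converges to `f ∈ ℂ ∪ {∞}`. -/
def CFConvergesTo (b₀ : ℂ) (α β : ℕ → ℂ) (f : OnePoint ℂ) : Prop :=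
  Tendsto (cfApproximant b₀ α β) atTop (𝓝 f)

/-! ### Quotients in the extended complex plane -/

/-! Put `p = q ^ 2`, `d = a * b`, `e = (a ^ 2 + b ^ 2) * q`; the partial numerators become `d * (1 +
p ^ (2 * n + 1)) - e * p ^ n` and tend to `d`.

For `‖d‖ < 1` the argument is of Pincherle type. If `h` solves the backward recurrence `h n = β n *
h (n + 1) + α (n + 1) * h (n + 2)` and tends to `1`, an invariant (`cfRec_mul_add`) turns the
second-order recurrence for the numerators and denominators of the approximants into a first-order
one with limiting multiplier `-d`. Both sequences converge, and the value is `(b₀ * h 0 + α 0 * h 1)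
/ h 0` (`cfConvergesTo_of_solution`). Such an `h` is `H (p ^ n)` for a power series `H` with `H 0 =
1` (`minSol`).

Evaluation: `minSol_contiguous` links `(d, e)` to `(d * p, e * p)`, that is `(a, b)` to `(a * q, b *
q)`. Each such step interchanges the roles of numerator `minNum` and denominator `minSol`; two steps
split off an elementary factor, and iteration yields the infinite products. The factors `(-abq²;
q²)_∞` and `minSol p 0 0 0` are common to both and cancel.

The case `‖a * b‖ > 1` follows by passing to `a⁻¹`, `b⁻¹` and an equivalence transformation with
constant `-(a * b)`. -/

theorem extDiv_mul_left {c : ℂ} (hc : c ≠ 0) (x y : ℂ) :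
    extDiv (c * x) (c * y) = extDiv x y := by
  unfold extDiv
  by_cases hy : y = 0
  · simp [hy]
  · simp [hy, hc, mul_div_mul_left]

theorem extDiv_one (x : ℂ) : extDiv x 1 = (x : OnePoint ℂ) := by
  simp [extDiv]

theorem extDiv_of_ne {y : ℂ} (hy : y ≠ 0) (x : ℂ) :
    extDiv x y = ((x / y : ℂ) : OnePoint ℂ) := by
  simp [extDiv, hy]

theorem extDiv_zero (x : ℂ) : extDiv x 0 = OnePoint.infty := by
  simp [extDiv]

theorem map_mul_extDiv (c x y : ℂ) :
    OnePoint.map (fun z : ℂ => c * z) (extDiv x y) = extDiv (c * x) y := by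
  by_cases hy : y = 0
  · simp [hy, extDiv_zero]
  · simp [extDiv_of_ne hy, mul_div_assoc]

theorem tendsto_extDiv {x y : ℕ → ℂ} {x₀ y₀ : ℂ} (hx : Tendsto x atTop (𝓝 x₀))
    (hy : Tendsto y atTop (𝓝 y₀)) (h : x₀ ≠ 0 ∨ y₀ ≠ 0) :
    Tendsto (fun n => extDiv (x n) (y n)) atTop (𝓝 (extDiv x₀ y₀)) := by
  by_cases hy0 : y₀ = 0
  · subst hy0
    have hx0 : x₀ ≠ 0 := by simpa using h
    rw [extDiv_zero, (OnePoint.hasBasis_nhds_infty (X := ℂ)).tendsto_right_iff]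
    rintro s ⟨-, hs⟩
    obtain ⟨R, hR⟩ := hs.isBounded.exists_norm_le
    have hlim : Tendsto (fun n => ‖x n‖ - (|R| + 1) * ‖y n‖) atTop (𝓝 (‖x₀‖ - (|R| + 1) * ‖(0 : ℂ)‖)) :=
      hx.norm.sub (hy.norm.const_mul _)
    have hpos : 0 < ‖x₀‖ - (|R| + 1) * ‖(0 : ℂ)‖ := by simpa using hx0
    filter_upwards [hlim.eventually_const_lt hpos] with n hn
    by_cases hyn : y n = 0
    · simp [hyn, extDiv_zero]
    · rw [extDiv_of_ne hyn]
      left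
      refine ⟨_, fun hmem => ?_, rfl⟩
      have h1 := hR _ hmem
      rw [norm_div, div_le_iff₀ (norm_pos_iff.2 hyn)] at h1
      have h2 : R * ‖y n‖ ≤ (|R| + 1) * ‖y n‖ :=
        mul_le_mul_of_nonneg_right (by linarith [le_abs_self R]) (norm_nonneg _)
      linarith
  · rw [extDiv_of_ne hy0]
    have h1 : Tendsto (fun n => ((x n / y n : ℂ) : OnePoint ℂ)) atTop
        (𝓝 ((x₀ / y₀ : ℂ) : OnePoint ℂ)) :=
      (OnePoint.continuous_coe.tendsto _).comp (hx.div hy hy0)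
    refine h1.congr' ?_
    filter_upwards [hy.eventually_ne hy0] with n hn
    rw [extDiv_of_ne hn]

/-! ### Continued fractions as quotients of solutions of the three-term recurrence -/

/-- The solution of `x (n + 2) = β n * x (n + 1) + α n * x n` with given initial values. -/
def cfRec (x₀ x₁ : ℂ) (α β : ℕ → ℂ) : ℕ → ℂ
  | 0 => x₀
  | 1 => x₁
  | n + 2 => β n * cfRec x₀ x₁ α β (n + 1) + α n * cfRec x₀ x₁ α β n

/-- Indices are shifted by one: `cfRec` at `0` holds the conventional values of index `-1`, so index
`n + 1` belongs to the `n`-th approximant. The value at `∞` is carried along because `β n + z = 0`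
sends a finite argument there. -/
theorem cfMap_eq_extDiv (b₀ : ℂ) (α β : ℕ → ℂ) (n : ℕ) (hα : ∀ k < n, α k ≠ 0) :
    (∀ z : ℂ, cfMap b₀ α β n (z : OnePoint ℂ) =
      extDiv (cfRec 1 b₀ α β (n + 1) + z * cfRec 1 b₀ α β n)
        (cfRec 0 1 α β (n + 1) + z * cfRec 0 1 α β n)) ∧
    cfMap b₀ α β n OnePoint.infty = extDiv (cfRec 1 b₀ α β n) (cfRec 0 1 α β n) := by
  induction n with
  | zero => simp [cfMap, cfRec, extDiv_one, extDiv_zero]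
  | succ n ih =>
    obtain ⟨ih₁, ih₂⟩ := ih fun k hk => hα k (by omega)
    have hn : α n ≠ 0 := hα n (by omega)
    refine ⟨fun z => ?_, ?_⟩
    · have hs : cfStep (α n) (β n) (z : OnePoint ℂ) = extDiv (α n) (β n + z) := by
        simp [cfStep, hn]
      rw [cfMap, hs]
      by_cases hz : β n + z = 0
      · rw [hz, extDiv_zero, ih₂, ← extDiv_mul_left hn]
        simp only [cfRec]
        congr 1
        · linear_combination (-cfRec 1 b₀ α β (n + 1)) * hz
        · linear_combination (-cfRec 0 1 α β (n + 1)) * hz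
      · rw [extDiv_of_ne hz, ih₁, ← extDiv_mul_left hz]
        simp only [cfRec]
        congr 1 <;> field_simp <;> ring
    · have hs : cfStep (α n) (β n) OnePoint.infty = ((0 : ℂ) : OnePoint ℂ) := by
        simp [cfStep]
      rw [cfMap, hs, ih₁]
      simp

theorem cfMap_eq_of_terminates (b₀ : ℂ) (α β : ℕ → ℂ) {N : ℕ} (hN : α N = 0) {n : ℕ}
    (hn : N < n) (w : OnePoint ℂ) : cfMap b₀ α β n w = cfMap b₀ α β N ((0 : ℂ) : OnePoint ℂ) := by
  induction n, hn using Nat.le_induction generalizing w with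
  | base => simp [cfMap, cfStep, hN]
  | succ n _ ih => rw [cfMap, ih]

/-- The forward recurrence of `cfRec` and the backward one of `h` are adjoint, so this pairing does
not depend on `n`. -/
theorem cfRec_mul_add (x₀ x₁ : ℂ) {α β h : ℕ → ℂ}
    (hh : ∀ n, h n = β n * h (n + 1) + α (n + 1) * h (n + 2)) (n : ℕ) :
    cfRec x₀ x₁ α β (n + 1) * h n + α n * cfRec x₀ x₁ α β n * h (n + 1) =
      x₁ * h 0 + α 0 * x₀ * h 1 := by
  induction n with
  | zero => simp [cfRec]
  | succ n ih =>
    rw [← ih, hh n]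
    simp only [cfRec]
    ring

theorem tendsto_zero_of_norm_succ_le {x u : ℕ → ℝ} {r : ℝ} (hr0 : 0 ≤ r) (hr : r < 1)
    (hx0 : ∀ n, 0 ≤ x n) (hu : Tendsto u atTop (𝓝 0))
    (hx : ∀ᶠ n in atTop, x (n + 1) ≤ r * x n + u n) : Tendsto x atTop (𝓝 0) := by
  rw [Metric.tendsto_atTop]
  intro ε hε
  -- Chosen so that `ε / 2` is the fixed point of `y ↦ r * y + ε / 2 * (1 - r)`.
  have hε' : 0 < ε / 2 * (1 - r) := by have := sub_pos.2 hr; positivity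
  obtain ⟨N, hN⟩ := eventually_atTop.1 (hx.and (hu.eventually_lt_const hε'))
  have hb : ∀ k, x (N + k) ≤ r ^ k * x N + ε / 2 := by
    intro k
    induction k with
    | zero => simp; linarith
    | succ k ih =>
      have h1 := (hN (N + k) (by omega)).1
      have h2 := (hN (N + k) (by omega)).2
      have h3 := mul_le_mul_of_nonneg_left ih hr0
      rw [← add_assoc, pow_succ]
      nlinarith
  have hlim : Tendsto (fun k => r ^ k * x N) atTop (𝓝 (0 * x N)) :=
    (tendsto_pow_atTop_nhds_zero_of_lt_one hr0 hr).mul_const _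
  rw [zero_mul] at hlim
  obtain ⟨M, hM⟩ := eventually_atTop.1 (hlim.eventually_lt_const (half_pos hε))
  refine ⟨N + M, fun n hn => ?_⟩
  obtain ⟨k, rfl⟩ : ∃ k, n = N + k := ⟨n - N, by omega⟩
  rw [Real.dist_eq, sub_zero, abs_of_nonneg (hx0 _)]
  linarith [hb k, hM k (by omega)]

/-- The limit is the fixed point of the limiting affine map; the deviation from it is contracted up
to an error tending to `0`. -/
theorem tendsto_of_affine_recurrence {x u v : ℕ → ℂ} {u₀ v₀ : ℂ} (hu : Tendsto u atTop (𝓝 u₀))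
    (hv : Tendsto v atTop (𝓝 v₀)) (hv₀ : ‖v₀‖ < 1)
    (hx : ∀ᶠ n in atTop, x (n + 1) = u n + v n * x n) :
    Tendsto x atTop (𝓝 (u₀ / (1 - v₀))) := by
  have h1 : 1 - v₀ ≠ 0 := by
    intro h
    rw [← sub_eq_zero.1 h] at hv₀
    simp at hv₀
  obtain ⟨r, hr, hr1⟩ := exists_between hv₀
  set l := u₀ / (1 - v₀) with hl
  have hl' : u₀ + v₀ * l = l := by rw [hl]; field_simp; ring
  have hw : Tendsto (fun n => ‖u n + v n * l - l‖) atTop (𝓝 0) := by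
    have := ((hu.add (hv.mul_const l)).sub_const l).norm
    simpa [hl'] using this
  refine tendsto_iff_norm_sub_tendsto_zero.2 ?_
  refine tendsto_zero_of_norm_succ_le ((norm_nonneg _).trans hr.le) hr1
    (fun n => norm_nonneg _) hw ?_
  filter_upwards [hx, hv.norm.eventually_lt_const hr] with n hn hvn
  have : x (n + 1) - l = v n * (x n - l) + (u n + v n * l - l) := by rw [hn]; ring
  rw [this]
  refine (norm_add_le _ _).trans ?_
  rw [norm_mul]
  gcongr

/-- If the recurrence `h n = β n * h (n + 1) + α (n + 1) * h (n + 2)` has a solution tending to a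
nonzero limit, and `α` tends to a limit in the open unit disc, then the continued fraction
`b₀ + K (α k / β k)` converges to `(b₀ * h 0 + α 0 * h 1) / h 0`. -/
theorem cfConvergesTo_of_solution (b₀ : ℂ) {α β h : ℕ → ℂ} {d : ℂ} (hd : ‖d‖ < 1)
    (hα : Tendsto α atTop (𝓝 d)) (hlim : Tendsto h atTop (𝓝 1))
    (hh : ∀ n, h n = β n * h (n + 1) + α (n + 1) * h (n + 2))
    (hne : b₀ * h 0 + α 0 * h 1 ≠ 0 ∨ h 0 ≠ 0) :
    CFConvergesTo b₀ α β (extDiv (b₀ * h 0 + α 0 * h 1) (h 0)) := by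
  have hA := cfRec_mul_add 1 b₀ hh
  have hB := cfRec_mul_add 0 1 hh
  simp only [mul_one, one_mul, mul_zero, zero_mul, add_zero] at hA hB
  unfold CFConvergesTo
  by_cases hterm : ∃ N, α N = 0
  · classical
    have hN := Nat.find_spec hterm
    have hlt := fun k (hk : k < Nat.find hterm) => Nat.find_min hterm hk
    set N := Nat.find hterm
    -- At the first zero of `α` the second term of the invariant drops out, so this approximant
    -- already has the claimed value.
    have hval : cfApproximant b₀ α β N = extDiv (b₀ * h 0 + α 0 * h 1) (h 0) := by
      rw [cfApproximant, (cfMap_eq_extDiv b₀ α β N hlt).1 0, ← hA N, ← hB N, hN]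
      have hhN : h N ≠ 0 := by
        intro h0
        rw [← hA N, ← hB N, hN, h0] at hne
        simp at hne
      rw [← extDiv_mul_left hhN]
      congr 1 <;> ring
    refine tendsto_const_nhds.congr' ?_
    filter_upwards [eventually_gt_atTop N] with n hn
    rw [cfApproximant, cfMap_eq_of_terminates b₀ α β hN hn, ← hval, cfApproximant]
  · push Not at hterm
    -- Solving the invariant for `X (n + 1)` gives an affine recurrence with multiplier tending to
    -- `-d`.
    have key : ∀ (X : ℕ → ℂ) (F : ℂ), (∀ n, X (n + 1) * h n + α n * X n * h (n + 1) = F) →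
        Tendsto X atTop (𝓝 (F / (1 + d))) := by
      intro X F hX
      have h1 : Tendsto (fun n => h (n + 1)) atTop (𝓝 1) := hlim.comp (tendsto_add_atTop_nat 1)
      have hu : Tendsto (fun n => F / h n) atTop (𝓝 (F / 1)) := tendsto_const_nhds.div hlim one_ne_zero
      have hv : Tendsto (fun n => -(α n * h (n + 1) / h n)) atTop (𝓝 (-(d * 1 / 1))) :=
        ((hα.mul h1).div hlim one_ne_zero).neg
      simp only [div_one, mul_one] at hu hv
      have := tendsto_of_affine_recurrence (x := X) hu hv (by simpa using hd) ?_
      · simpa using this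
      · filter_upwards [hlim.eventually_ne one_ne_zero] with n hn
        rw [← hX n]
        field_simp
        ring
    have hd1 : 1 + d ≠ 0 := by
      intro h0
      rw [eq_neg_of_add_eq_zero_right h0] at hd
      simp at hd
    have hT := tendsto_extDiv ((key _ _ hA).comp (tendsto_add_atTop_nat 1))
      ((key _ _ hB).comp (tendsto_add_atTop_nat 1))
      (hne.imp (div_ne_zero · hd1) (div_ne_zero · hd1))
    have hsc : extDiv ((b₀ * h 0 + α 0 * h 1) / (1 + d)) (h 0 / (1 + d)) =
        extDiv (b₀ * h 0 + α 0 * h 1) (h 0) := by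
      rw [← extDiv_mul_left (inv_ne_zero hd1) (b₀ * h 0 + α 0 * h 1)]
      congr 1 <;> ring
    rw [hsc] at hT
    refine hT.congr fun n => ?_
    rw [cfApproximant, (cfMap_eq_extDiv b₀ α β n fun k _ => hterm k).1 0]
    simp

/-! ### Equivalence transformation by a constant -/

theorem cfStep_scale {c : ℂ} (hc : c ≠ 0) (α β : ℂ) (w : OnePoint ℂ) :
    cfStep (c ^ 2 * α) (c * β) (OnePoint.map (fun z : ℂ => c * z) w) =
      OnePoint.map (fun z : ℂ => c * z) (cfStep α β w) := by
  by_cases hα : α = 0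
  · simp [cfStep, hα]
  · induction w using OnePoint.rec with
    | infty => simp [cfStep]
    | coe z =>
      have h1 : cfStep α β (z : OnePoint ℂ) = extDiv α (β + z) := by simp [cfStep, hα]
      have h2 : cfStep (c ^ 2 * α) (c * β) ((c * z : ℂ) : OnePoint ℂ) =
          extDiv (c ^ 2 * α) (c * β + c * z) := by simp [cfStep, hα, hc]
      rw [OnePoint.map_some, h1, h2, map_mul_extDiv, ← extDiv_mul_left hc (c * α)]
      congr 1 <;> ring

theorem cfMap_scale {c : ℂ} (hc : c ≠ 0) (b₀ : ℂ) (α β : ℕ → ℂ) (n : ℕ) (w : OnePoint ℂ) :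
    cfMap (c * b₀) (fun k => c ^ 2 * α k) (fun k => c * β k) n
        (OnePoint.map (fun z : ℂ => c * z) w) =
      OnePoint.map (fun z : ℂ => c * z) (cfMap b₀ α β n w) := by
  induction n generalizing w with
  | zero =>
    induction w using OnePoint.rec with
    | infty => simp [cfMap]
    | coe z => simp [cfMap, mul_add]
  | succ n ih => rw [cfMap, cfMap, cfStep_scale hc, ih]

theorem continuous_map_mul {c : ℂ} (hc : c ≠ 0) :
    Continuous (OnePoint.map (fun z : ℂ => c * z)) :=
  OnePoint.continuous_map (continuous_const_mul c) <| by
    rw [coclosedCompact_eq_cocompact]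
    exact (Homeomorph.mulLeft₀ c hc).isClosedEmbedding.tendsto_cocompact

theorem CFConvergesTo.scale {c : ℂ} (hc : c ≠ 0) {b₀ : ℂ} {α β : ℕ → ℂ} {x y : ℂ}
    (h : CFConvergesTo b₀ α β (extDiv x y)) :
    CFConvergesTo (c * b₀) (fun k => c ^ 2 * α k) (fun k => c * β k) (extDiv (c * x) y) := by
  rw [← map_mul_extDiv]
  refine (((continuous_map_mul hc).tendsto _).comp h).congr fun n => ?_
  rw [Function.comp, cfApproximant, cfApproximant, ← cfMap_scale hc]
  simp

/-! ### The minimal solution of the recurrence -/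

/-- The partial numerators `d * (1 + p ^ (2 * n + 1)) - e * p ^ n`. -/
def cfNum (p d e : ℂ) (n : ℕ) : ℂ := d * (1 + p ^ (2 * n + 1)) - e * p ^ n

/-- The partial denominators `(1 - d) * (1 + p ^ (n + 1))`. -/
def cfDen (p d : ℂ) (n : ℕ) : ℂ := (1 - d) * (1 + p ^ (n + 1))

/-- The coefficients of the normalized power series solution `H` of
`H (x) = (1 - d) * (1 + p * x) * H (p * x) + (d * (1 + p ^ 3 * x ^ 2) - e * p * x) * H (p ^ 2 * x)`. -/
noncomputable def minCoeff (p d e : ℂ) : ℕ → ℂ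
  | 0 => 1
  | 1 => ((1 - d) * p - e * p) / ((1 - p) * (1 + d * p))
  | k + 2 => (((1 - d) * p ^ (k + 2) - e * p ^ (2 * k + 3)) * minCoeff p d e (k + 1) +
      d * p ^ (2 * k + 3) * minCoeff p d e k) / ((1 - p ^ (k + 2)) * (1 + d * p ^ (k + 2)))

/-- The solution of the three-term recurrence that tends to `1`. -/
noncomputable def minSol (p d e : ℂ) (n : ℕ) : ℂ := ∑' k : ℕ, minCoeff p d e k * (p ^ n) ^ k

theorem one_sub_norm_le_norm_one_add (z : ℂ) : 1 - ‖z‖ ≤ ‖1 + z‖ := by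
  simpa using norm_sub_norm_le (1 : ℂ) (-z)

theorem one_add_mul_pow_ne_zero {p d : ℂ} (hp : ‖p‖ < 1) (hd : ‖d‖ < 1) (k : ℕ) :
    1 + d * p ^ k ≠ 0 := by
  have h1 : ‖d * p ^ k‖ < 1 := by
    rw [norm_mul, norm_pow]
    exact (mul_le_of_le_one_right (norm_nonneg _) (pow_le_one₀ (norm_nonneg _) hp.le)).trans_lt hd
  have := one_sub_norm_le_norm_one_add (d * p ^ k)
  exact norm_pos_iff.1 (by linarith)

theorem one_sub_pow_succ_ne_zero {p : ℂ} (hp : ‖p‖ < 1) (k : ℕ) : 1 - p ^ (k + 1) ≠ 0 := by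
  have := one_add_mul_pow_ne_zero (d := -p) hp (by simpa using hp) k
  rwa [neg_mul, ← pow_succ', ← sub_eq_add_neg] at this

/-- Geometric bound for a sequence generated by a second-order recurrence with geometrically
decaying coefficients. -/
theorem norm_le_geometric_of_recurrence {c : ℕ → ℂ} {ρ K : ℝ} (hρ0 : 0 ≤ ρ) (hρ : ρ < 1)
    (hK : 0 ≤ K) (h0 : ‖c 0‖ ≤ 1) (h1 : ‖c 1‖ ≤ K * ρ)
    (hc : ∀ k, ‖c (k + 2)‖ ≤ K * ρ ^ (k + 2) * (‖c (k + 1)‖ + ‖c k‖)) (k : ℕ) :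
    ‖c k‖ ≤ (1 + 2 * K) * Real.exp (2 * K / (1 - ρ)) * ρ ^ k := by
  -- Each step enlarges the bound by at most `1 + 2 * K * ρ ^ (k + 2)`, hence by at most its
  -- exponential. This gives boundedness; inserting it once more into the recurrence gives the decay
  -- `ρ ^ k`.
  have hbound : ∀ k, ‖c k‖ ≤ Real.exp (∑ j ∈ Finset.range (k + 1), 2 * K * ρ ^ j) ∧
      ‖c (k + 1)‖ ≤ Real.exp (∑ j ∈ Finset.range (k + 2), 2 * K * ρ ^ j) := by
    intro k
    induction k with
    | zero =>
      refine ⟨h0.trans (Real.one_le_exp (by simpa using hK)), h1.trans ?_⟩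
      refine le_trans ?_ (Real.add_one_le_exp _)
      have := mul_nonneg hK hρ0
      simp only [zero_add, Finset.sum_range_succ, Finset.sum_range_zero]
      linarith
    | succ k ih =>
      refine ⟨ih.2, ?_⟩
      rw [Finset.sum_range_succ, Real.exp_add]
      set E := Real.exp (∑ j ∈ Finset.range (k + 2), 2 * K * ρ ^ j)
      have hE : 0 ≤ E := (Real.exp_pos _).le
      have hle : ‖c k‖ ≤ E := ih.1.trans <| Real.exp_le_exp.2 <| by
        rw [Finset.sum_range_succ _ (k + 1)]
        exact le_add_of_nonneg_right (by positivity)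
      have hx : 0 ≤ K * ρ ^ (k + 2) := by positivity
      calc ‖c (k + 2)‖ ≤ K * ρ ^ (k + 2) * (E + E) := (hc k).trans (by gcongr; exact ih.2)
        _ ≤ E * (2 * K * ρ ^ (k + 2) + 1) := by nlinarith
        _ ≤ _ := by gcongr; exact Real.add_one_le_exp _
  have hρ' : 0 < 1 - ρ := sub_pos.2 hρ
  set C := Real.exp (2 * K / (1 - ρ))
  have hC : ∀ k, ‖c k‖ ≤ C := fun k => (hbound k).1.trans <| Real.exp_le_exp.2 <| by
    rw [← Finset.mul_sum, div_eq_mul_inv, ← tsum_geometric_of_lt_one hρ0 hρ]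
    gcongr
    exact (summable_geometric_of_lt_one hρ0 hρ).sum_le_tsum _ fun _ _ => by positivity
  have hC1 : 1 ≤ C := Real.one_le_exp (by positivity)
  match k with
  | 0 => rw [pow_zero, mul_one]; nlinarith
  | 1 =>
    rw [pow_one]
    refine h1.trans ?_
    gcongr
    nlinarith
  | k + 2 =>
    refine (hc k).trans ?_
    have hx : 0 ≤ ρ ^ (k + 2) := by positivity
    calc K * ρ ^ (k + 2) * (‖c (k + 1)‖ + ‖c k‖) ≤ K * ρ ^ (k + 2) * (C + C) := by
          gcongr <;> exact hC _
      _ = (2 * K) * C * ρ ^ (k + 2) := by ring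
      _ ≤ (1 + 2 * K) * C * ρ ^ (k + 2) := by gcongr; linarith

/-- Coefficient bound, uniform for `‖d‖ ≤ δ < 1` and `‖e‖ ≤ σ`. -/
theorem exists_norm_minCoeff_le {p : ℂ} (hp : ‖p‖ < 1) {δ : ℝ} (hδ : δ < 1) (σ : ℝ) :
    ∃ C : ℝ, ∀ d e : ℂ, ‖d‖ ≤ δ → ‖e‖ ≤ σ → ∀ k, ‖minCoeff p d e k‖ ≤ C * ‖p‖ ^ k := by
  set ρ := ‖p‖ with hρ
  have hρ0 : 0 ≤ ρ := norm_nonneg p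
  have hD : 0 < (1 - ρ) * (1 - δ) := mul_pos (sub_pos.2 hp) (sub_pos.2 hδ)
  refine ⟨(1 + 2 * ((2 + |σ|) / ((1 - ρ) * (1 - δ)))) *
    Real.exp (2 * ((2 + |σ|) / ((1 - ρ) * (1 - δ))) / (1 - ρ)), fun d e hd he k => ?_⟩
  have he' : ‖e‖ ≤ |σ| := he.trans (le_abs_self σ)
  have hd1 : ‖d‖ ≤ 1 := hd.trans hδ.le
  have hden : ∀ k, (1 - ρ) * (1 - δ) ≤ ‖(1 - p ^ (k + 1)) * (1 + d * p ^ (k + 1))‖ := by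
    intro k
    rw [norm_mul]
    have hpk : ρ ^ (k + 1) ≤ 1 := pow_le_one₀ hρ0 hp.le
    refine mul_le_mul ?_ ?_ (sub_pos.2 hδ).le (norm_nonneg _)
    · have h1 := one_sub_norm_le_norm_one_add (-p ^ (k + 1))
      rw [norm_neg, norm_pow, ← sub_eq_add_neg] at h1
      have h2 : ρ ^ (k + 1) ≤ ρ := by
        rw [pow_succ]
        exact mul_le_of_le_one_left hρ0 (pow_le_one₀ hρ0 hp.le)
      linarith
    · have h1 := one_sub_norm_le_norm_one_add (d * p ^ (k + 1))
      rw [norm_mul, norm_pow] at h1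
      have h2 : ‖d‖ * ρ ^ (k + 1) ≤ ‖d‖ := mul_le_of_le_one_right (norm_nonneg _) hpk
      linarith
  have hnum : ∀ k j, k ≤ j → ‖(1 - d) * p ^ k - e * p ^ j‖ ≤ (2 + |σ|) * ρ ^ k := by
    intro k j hkj
    have h1 : ‖1 - d‖ ≤ 2 := (norm_sub_le _ _).trans (by rw [norm_one]; linarith)
    have h2 : ρ ^ j ≤ ρ ^ k := pow_le_pow_of_le_one hρ0 hp.le hkj
    calc _ ≤ ‖1 - d‖ * ρ ^ k + ‖e‖ * ρ ^ j := by
          refine (norm_sub_le _ _).trans ?_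
          rw [norm_mul, norm_mul, norm_pow, norm_pow]
      _ ≤ 2 * ρ ^ k + |σ| * ρ ^ k := by gcongr
      _ = _ := by ring
  refine norm_le_geometric_of_recurrence hρ0 hp (by positivity) (by simp [minCoeff]) ?_ ?_ k
  · have h1 := hnum 1 1 le_rfl
    have h2 := hden 0
    simp only [zero_add, pow_one] at h1 h2
    rw [minCoeff, norm_div, div_mul_eq_mul_div]
    exact div_le_div₀ (by positivity) h1 hD h2
  · intro k
    rw [minCoeff, norm_div, div_mul_eq_mul_div, div_mul_eq_mul_div]
    refine div_le_div₀ (by positivity) ?_ hD (hden (k + 1))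
    refine (norm_add_le _ _).trans ?_
    rw [mul_add, norm_mul, norm_mul]
    gcongr
    · exact hnum _ _ (by omega)
    · rw [norm_mul, norm_pow]
      have h2 : ρ ^ (2 * k + 3) ≤ ρ ^ (k + 2) := pow_le_pow_of_le_one hρ0 hp.le (by omega)
      have h3 : ‖d‖ ≤ 2 + |σ| := by linarith [abs_nonneg σ]
      gcongr

theorem summable_minCoeff_mul_pow {p d : ℂ} (hp : ‖p‖ < 1) (hd : ‖d‖ < 1) (e : ℂ) {x : ℂ}
    (hx : ‖x‖ ≤ 1) : Summable fun k => minCoeff p d e k * x ^ k := by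
  obtain ⟨C, hC⟩ := exists_norm_minCoeff_le hp hd ‖e‖
  refine Summable.of_norm_bounded
    ((summable_geometric_of_lt_one (norm_nonneg p) hp).mul_left C) fun k => ?_
  rw [norm_mul, norm_pow]
  exact (mul_le_of_le_one_right (norm_nonneg _) (pow_le_one₀ (norm_nonneg _) hx)).trans
    (hC d e le_rfl le_rfl k)

/-- Compare coefficients: that of `x ^ (k + 2)` rests on `1 - (1 - d) * P - d * P ^ 2 = (1 - P) * (1
+ d * P)` with `P = p ^ (k + 2)`. The two lowest orders are split off and treated separately. -/
theorem tsum_minCoeff_functional_equation {p d : ℂ} (hp : ‖p‖ < 1) (hd : ‖d‖ < 1) (e : ℂ) {x : ℂ}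
    (hx : ‖x‖ ≤ 1) :
    ∑' k, minCoeff p d e k * x ^ k =
      (1 - d) * (1 + p * x) * ∑' k, minCoeff p d e k * (p * x) ^ k +
        (d * (1 + p ^ 3 * x ^ 2) - e * p * x) * ∑' k, minCoeff p d e k * (p ^ 2 * x) ^ k := by
  have hmul : ∀ {u v : ℂ}, ‖u‖ ≤ 1 → ‖v‖ ≤ 1 → ‖u * v‖ ≤ 1 := fun hu hv => by
    rw [norm_mul]; exact mul_le_one₀ hu (norm_nonneg _) hv
  have hp2 : ‖p ^ 2‖ ≤ 1 := by rw [pow_two]; exact hmul hp.le hp.le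
  have s1 := summable_minCoeff_mul_pow hp hd e hx
  have s2 := summable_minCoeff_mul_pow hp hd e (hmul hp.le hx)
  have s3 := summable_minCoeff_mul_pow hp hd e (hmul hp2 hx)
  have t1 := (summable_nat_add_iff 1).2 s1
  have t2 := (summable_nat_add_iff 1).2 s2
  have t3 := (summable_nat_add_iff 1).2 s3
  have e1 := s1.tsum_eq_zero_add
  have e2 := s2.tsum_eq_zero_add
  have e3 := s3.tsum_eq_zero_add
  have f1 := t1.tsum_eq_zero_add
  have f2 := t2.tsum_eq_zero_add
  have f3 := t3.tsum_eq_zero_add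
  have h1 := ((summable_nat_add_iff 1).2 t1).hasSum
  have h2 := ((summable_nat_add_iff 1).2 t2).hasSum
  have h3 := ((summable_nat_add_iff 1).2 t3).hasSum
  have key := ((((h1.sub (h2.mul_left (1 - d))).sub (t2.hasSum.mul_left ((1 - d) * p * x))).sub
    (h3.mul_left d)).add (t3.hasSum.mul_left (e * p * x))).sub
      (s3.hasSum.mul_left (d * p ^ 3 * x ^ 2))
  have r1 : minCoeff p d e 1 * ((1 - p) * (1 + d * p)) = (1 - d) * p - e * p := by
    have h1 := one_sub_pow_succ_ne_zero hp 0
    have h2 := one_add_mul_pow_ne_zero hp hd 1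
    rw [zero_add, pow_one] at h1
    rw [pow_one] at h2
    rw [minCoeff, div_mul_cancel₀ _ (mul_ne_zero h1 h2)]
  have r2 : ∀ k, minCoeff p d e (k + 2) * ((1 - p ^ (k + 2)) * (1 + d * p ^ (k + 2))) =
      ((1 - d) * p ^ (k + 2) - e * p ^ (2 * k + 3)) * minCoeff p d e (k + 1) +
        d * p ^ (2 * k + 3) * minCoeff p d e k := fun k => by
    rw [minCoeff, div_mul_cancel₀ _ (mul_ne_zero (one_sub_pow_succ_ne_zero hp (k + 1))
      (one_add_mul_pow_ne_zero hp hd (k + 2)))]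
  have hz := key.tsum_eq.symm.trans ((tsum_congr (g := fun _ => (0 : ℂ)) fun k => by
    linear_combination x ^ (k + 2) * r2 k).trans tsum_zero)
  have c0 : minCoeff p d e 0 = 1 := by rw [minCoeff]
  simp only [zero_add, pow_zero, pow_one, c0, mul_one] at e1 e2 e3 f1 f2 f3
  linear_combination hz + e1 + f1 - (1 - d) * (1 + p * x) * e2 - (1 - d) * f2 - d * (e3 + f3) +
    e * p * x * e3 + x * r1

theorem minSol_recurrence {p d : ℂ} (hp : ‖p‖ < 1) (hd : ‖d‖ < 1) (e : ℂ) (n : ℕ) :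
    minSol p d e n =
      cfDen p d n * minSol p d e (n + 1) + cfNum p d e (n + 1) * minSol p d e (n + 2) := by
  have hx : ‖p ^ n‖ ≤ 1 := by
    rw [norm_pow]; exact pow_le_one₀ (norm_nonneg _) hp.le
  have h := tsum_minCoeff_functional_equation hp hd e hx
  rw [← pow_succ', ← pow_add, add_comm 2 n] at h
  unfold minSol cfDen cfNum
  rw [h]
  ring

theorem tendsto_minSol {p d : ℂ} (hp : ‖p‖ < 1) (hd : ‖d‖ < 1) (e : ℂ) :
    Tendsto (minSol p d e) atTop (𝓝 1) := by
  obtain ⟨C, hC⟩ := exists_norm_minCoeff_le hp hd ‖e‖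
  have h := tendsto_tsum_of_dominated_convergence (𝓕 := atTop)
    (f := fun n k => minCoeff p d e k * (p ^ n) ^ k) (g := fun k => minCoeff p d e k * 0 ^ k)
    (bound := fun k => C * ‖p‖ ^ k)
    ((summable_geometric_of_lt_one (norm_nonneg p) hp).mul_left C)
    (fun k => ((tendsto_pow_atTop_nhds_zero_of_norm_lt_one hp).pow k).const_mul _)
    (Eventually.of_forall fun n k => by
      rw [norm_mul, norm_pow, norm_pow]
      exact (mul_le_of_le_one_right (norm_nonneg _)
        (pow_le_one₀ (by positivity) (pow_le_one₀ (norm_nonneg _) hp.le))).trans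
        (hC d e le_rfl le_rfl k))
  rw [tsum_eq_single 0 fun k hk => by simp [hk]] at h
  simp only [pow_zero, mul_one, minCoeff] at h
  exact h

theorem tendsto_cfNum {p : ℂ} (hp : ‖p‖ < 1) (d e : ℂ) :
    Tendsto (cfNum p d e) atTop (𝓝 d) := by
  have h := tendsto_pow_atTop_nhds_zero_of_norm_lt_one hp
  have h2 : Tendsto (fun n : ℕ => p ^ (2 * n + 1)) atTop (𝓝 0) :=
    h.comp (tendsto_atTop_mono (fun n => (by omega : n ≤ 2 * n + 1)) tendsto_id)
  have h3 := ((h2.const_add 1).const_mul d).sub (h.const_mul e)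
  rwa [add_zero, mul_one, mul_zero, sub_zero] at h3

/-- A solution tending to `0` vanishes as soon as there is a solution with a nonzero limit. -/
theorem eq_zero_of_recurrence_of_tendsto_zero {α β h w : ℕ → ℂ} {d : ℂ} (hd : ‖d‖ < 1)
    (hα : Tendsto α atTop (𝓝 d)) (hh : ∀ n, h n = β n * h (n + 1) + α (n + 1) * h (n + 2))
    (hw : ∀ n, w n = β n * w (n + 1) + α (n + 1) * w (n + 2))
    (hlim : Tendsto h atTop (𝓝 1)) (hwlim : Tendsto w atTop (𝓝 0)) (n : ℕ) : w n = 0 := by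
  set D : ℕ → ℂ := fun n => w n * h (n + 1) - w (n + 1) * h n with hDdef
  have hDlim : Tendsto D atTop (𝓝 0) := by
    have h1 := hlim.comp (tendsto_add_atTop_nat 1)
    have h2 := hwlim.comp (tendsto_add_atTop_nat 1)
    simpa using (hwlim.mul h1).sub (h2.mul hlim)
  -- The Casoratian `D` tends to `0`, yet `‖D n‖` is eventually nondecreasing since `‖α n‖ < 1`; so
  -- it vanishes from some index on and `w / h` is constant there.
  have hDrec : ∀ n, D n = -α (n + 1) * D (n + 1) := fun n => by
    simp only [hDdef]
    rw [hh n, hw n]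
    ring
  obtain ⟨N, hN⟩ := eventually_atTop.1
    ((hα.norm.eventually_lt_const hd).and (hlim.eventually_ne one_ne_zero))
  have hD0 : ∀ n, N ≤ n → D n = 0 := by
    intro n hn
    have hmono : ∀ k, ‖D n‖ ≤ ‖D (n + k)‖ := by
      intro k
      induction k with
      | zero => simp
      | succ k ih =>
        refine ih.trans ?_
        rw [hDrec (n + k), norm_mul, norm_neg, ← add_assoc]
        exact mul_le_of_le_one_left (norm_nonneg _) (hN (n + k + 1) (by omega)).1.le
    have hl : Tendsto (fun k => ‖D (n + k)‖) atTop (𝓝 0) := by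
      have := (hDlim.comp (tendsto_add_atTop_nat n)).norm
      simpa [Function.comp_def, add_comm] using this
    exact norm_le_zero_iff.1 (ge_of_tendsto' hl hmono)
  have hconst : ∀ n, N ≤ n → ∀ k, w (n + k) / h (n + k) = w n / h n := by
    intro n hn k
    induction k with
    | zero => rfl
    | succ k ih =>
      rw [← ih, ← add_assoc, div_eq_div_iff (hN (n + k + 1) (by omega)).2 (hN (n + k) (by omega)).2]
      have := hD0 (n + k) (by omega)
      simp only [hDdef] at this
      linear_combination -this
  have hw0 : ∀ n, N ≤ n → w n = 0 := by
    intro n hn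
    have hl : Tendsto (fun k => w (k + n) / h (k + n)) atTop (𝓝 (0 / 1)) :=
      (hwlim.comp (tendsto_add_atTop_nat n)).div (hlim.comp (tendsto_add_atTop_nat n)) one_ne_zero
    have hc : (fun k => w (k + n) / h (k + n)) = fun _ => w n / h n :=
      funext fun k => by rw [add_comm k n, hconst n hn]
    rw [hc] at hl
    have h0 := tendsto_nhds_unique hl tendsto_const_nhds
    rw [zero_div] at h0
    exact (div_eq_zero_iff.1 h0.symm).resolve_right (hN n hn).2
  -- The recurrence determines earlier terms from later ones, so vanishing propagates down to index
  -- `0`.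
  have hback : ∀ m, w (N - m) = 0 ∧ w (N - m + 1) = 0 := by
    intro m
    induction m with
    | zero => exact ⟨hw0 _ (by omega), hw0 _ (by omega)⟩
    | succ m ih =>
      by_cases hm : N ≤ m
      · rw [show N - (m + 1) = N - m by omega]; exact ih
      · have h1 : N - m = N - (m + 1) + 1 := by omega
        rw [h1] at ih
        exact ⟨by rw [hw, ih.1, ih.2]; ring, ih.1⟩
  by_cases hn : N ≤ n
  · exact hw0 n hn
  · have := (hback (N - n)).1
    rwa [show N - (N - n) = n by omega] at this

theorem norm_mul_lt_one {d p : ℂ} (hd : ‖d‖ < 1) (hp : ‖p‖ < 1) : ‖d * p‖ < 1 := by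
  rw [norm_mul]
  exact mul_lt_one_of_nonneg_of_lt_one_left (norm_nonneg _) hd hp.le

/-- The contiguous relation between the parameters `(d, e)` and `(d * p, e * p)`. -/
theorem minSol_contiguous {p d : ℂ} (hp : ‖p‖ < 1) (hd : ‖d‖ < 1) (e : ℂ) (n : ℕ) :
    (1 + d * p) * minSol p d e n = (1 - d * p ^ (n + 1)) * minSol p (d * p) (e * p) n +
      p * cfNum p d e n * minSol p (d * p) (e * p) (n + 1) := by
  have hdp := norm_mul_lt_one hd hp
  have hl := tendsto_minSol hp hd e
  have hl' := tendsto_minSol hp hdp (e * p)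
  have hr := minSol_recurrence hp hd e
  have hr' := minSol_recurrence hp hdp (e * p)
  set h := minSol p d e
  set g := minSol p (d * p) (e * p)
  have hpow := tendsto_pow_atTop_nhds_zero_of_norm_lt_one hp
  have hα := tendsto_cfNum hp d e
  -- Both sides of the relation solve the recurrence for `(d, e)` and tend to `1 + d * p`, so their
  -- difference is a solution tending to `0`.
  have hzero := eq_zero_of_recurrence_of_tendsto_zero (α := cfNum p d e) (β := cfDen p d)
    (h := h) (w := fun n => (1 + d * p) * h n -
      ((1 - d * p ^ (n + 1)) * g n + p * cfNum p d e n * g (n + 1))) hd hα hr ?_ hl ?_ n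
  · linear_combination hzero
  · intro n
    have h1 := hr n
    have h2 := hr' n
    have h3 := hr' (n + 1)
    have h4 : n + 1 + 2 = n + 3 := rfl
    have h5 : n + 1 + 1 = n + 2 := rfl
    simp only [cfNum, cfDen, h4, h5] at h1 h2 h3 ⊢
    linear_combination (1 + d * p) * h1 - (1 - d * p ^ (n + 1)) * h2 -
      (d * (1 + p ^ (2 * (n + 1) + 1)) - e * p ^ (n + 1)) * h3
  · have := (hl.const_mul (1 + d * p)).sub
      ((((hpow.comp (tendsto_add_atTop_nat 1)).const_mul d).const_sub 1 |>.mul hl').add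
        ((hα.const_mul p).mul (hl'.comp (tendsto_add_atTop_nat 1))))
    refine (this.congr fun n => by simp).trans_eq ?_
    congr 1
    ring

/-! ### Evaluation by iterating the contiguous relation -/

/-- The companion `(1 - d) * h 0 + α 0 * h 1` of the value `h 0` of the minimal solution. -/
noncomputable def minNum (p d e : ℂ) : ℂ :=
  (1 - d) * minSol p d e 0 + cfNum p d e 0 * minSol p d e 1

theorem one_add_mul_minSol {p d : ℂ} (hp : ‖p‖ < 1) (hd : ‖d‖ < 1) (e : ℂ) :
    (1 + d * p) * minSol p d e 0 = minNum p (d * p) (e * p) := by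
  rw [minSol_contiguous hp hd, minNum]
  simp only [cfNum]
  ring

/-- The contiguous relations at `0` and `1` express the left side through three values for `(d * p,
e * p)`; the recurrence there removes all but the value at `0`. In the original parameters the
factor is `(1 - a ^ 2 * q) * (1 - b ^ 2 * q)`. -/
theorem one_add_mul_minNum {p d : ℂ} (hp : ‖p‖ < 1) (hd : ‖d‖ < 1) (e : ℂ) :
    (1 + d * p) * minNum p d e = (1 - e + d ^ 2 * p) * minSol p (d * p) (e * p) 0 := by
  have h0 := minSol_contiguous hp hd e 0
  have h1 := minSol_contiguous hp hd e 1
  have h2 := minSol_recurrence hp (norm_mul_lt_one hd hp) (e * p) 0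
  simp only [minNum, cfNum, cfDen, zero_add, Nat.reduceAdd, mul_zero, pow_zero, pow_one, mul_one] at h0 h1 h2 ⊢
  linear_combination (1 - d) * h0 + (d * (1 + p) - e) * h1 - (d * (1 + p) - e) * h2

theorem minNum_two_step {p d : ℂ} (hp : ‖p‖ < 1) (hd : ‖d‖ < 1) (e : ℂ) :
    (1 + d * p) * (1 + d * p ^ 2) * minNum p d e =
      (1 - e + d ^ 2 * p) * minNum p (d * p ^ 2) (e * p ^ 2) := by
  have h1 := one_add_mul_minNum hp hd e
  have h2 := one_add_mul_minSol hp (norm_mul_lt_one hd hp) (e * p)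
  rw [mul_assoc, mul_assoc, ← pow_two] at h2
  linear_combination (1 + d * p ^ 2) * h1 + (1 - e + d ^ 2 * p) * h2

theorem minSol_two_step {p d : ℂ} (hp : ‖p‖ < 1) (hd : ‖d‖ < 1) (e : ℂ) :
    (1 + d * p) * (1 + d * p ^ 2) * minSol p d e 0 =
      (1 - e * p + d ^ 2 * p ^ 3) * minSol p (d * p ^ 2) (e * p ^ 2) 0 := by
  have h1 := one_add_mul_minSol hp hd e
  have h2 := one_add_mul_minNum hp (norm_mul_lt_one hd hp) (e * p)
  rw [mul_assoc d, mul_assoc e, ← pow_two] at h2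
  linear_combination (1 + d * p ^ 2) * h1 + h2

/-- Stated for an abstract `Φ` so as to serve both `minNum` and `minSol`. -/
theorem prod_mul_eq_of_two_step {p d e : ℂ} (hp : ‖p‖ < 1) (hd : ‖d‖ < 1) {Φ : ℂ → ℂ → ℂ}
    {r : ℂ → ℂ → ℂ} (hΦ : ∀ d e : ℂ, ‖d‖ < 1 →
      (1 + d * p) * (1 + d * p ^ 2) * Φ d e = r d e * Φ (d * p ^ 2) (e * p ^ 2)) (M : ℕ) :
    (∏ i ∈ Finset.range (2 * M), (1 - -(d * p) * p ^ i)) * Φ d e =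
      (∏ j ∈ Finset.range M, r (d * p ^ (2 * j)) (e * p ^ (2 * j))) *
        Φ (d * p ^ (2 * M)) (e * p ^ (2 * M)) := by
  induction M with
  | zero => simp
  | succ M ih =>
    have hdM : ‖d * p ^ (2 * M)‖ < 1 := by
      rw [norm_mul, norm_pow]
      exact (mul_le_of_le_one_right (norm_nonneg _) (pow_le_one₀ (norm_nonneg _) hp.le)).trans_lt hd
    have h1 := hΦ (d * p ^ (2 * M)) (e * p ^ (2 * M)) hdM
    rw [mul_assoc d (p ^ (2 * M)) (p ^ 2), mul_assoc e (p ^ (2 * M)) (p ^ 2), ← pow_add] at h1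
    rw [show 2 * (M + 1) = 2 * M + 1 + 1 by ring, Finset.prod_range_succ, Finset.prod_range_succ,
      Finset.prod_range_succ]
    linear_combination (1 - -(d * p) * p ^ (2 * M)) * (1 - -(d * p) * p ^ (2 * M + 1)) * ih +
      (∏ j ∈ Finset.range M, r (d * p ^ (2 * j)) (e * p ^ (2 * j))) * h1

theorem tendsto_minCoeff {p : ℂ} (hp : ‖p‖ < 1) {d e : ℕ → ℂ} (hd : Tendsto d atTop (𝓝 0))
    (he : Tendsto e atTop (𝓝 0)) (k : ℕ) :
    Tendsto (fun n => minCoeff p (d n) (e n) k) atTop (𝓝 (minCoeff p 0 0 k)) := by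
  have hden : ∀ k, (1 - p ^ (k + 1)) * (1 + 0 * p ^ (k + 1)) ≠ 0 := fun k => by
    simpa using one_sub_pow_succ_ne_zero hp k
  have hden' : ∀ k, Tendsto (fun n => (1 - p ^ k) * (1 + d n * p ^ k)) atTop
      (𝓝 ((1 - p ^ k) * (1 + 0 * p ^ k))) := fun k =>
    ((hd.mul_const _).const_add 1).const_mul _
  have hboth : Tendsto (fun n => minCoeff p (d n) (e n) k) atTop (𝓝 (minCoeff p 0 0 k)) ∧
      Tendsto (fun n => minCoeff p (d n) (e n) (k + 1)) atTop (𝓝 (minCoeff p 0 0 (k + 1))) := by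
    induction k with
    | zero =>
      refine ⟨by simp [minCoeff], ?_⟩
      have h1 := hden 0
      have h2 := hden' 1
      simp only [zero_add, pow_one] at h1 h2
      simp only [minCoeff]
      exact (((hd.const_sub 1).mul_const _).sub (he.mul_const _)).div h2 h1
    | succ k ih =>
      refine ⟨ih.2, ?_⟩
      simp only [minCoeff]
      exact (((((hd.const_sub 1).mul_const _).sub (he.mul_const _)).mul ih.2).add
        ((hd.mul_const _).mul ih.1)).div (hden' (k + 2)) (hden (k + 1))
  exact hboth.1

/-- Dominated convergence; the coefficient bound must be uniform in the parameters, which vary with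
`m`. -/
theorem tendsto_minSol_param {p : ℂ} (hp : ‖p‖ < 1) {d e : ℂ} (hd : ‖d‖ < 1) :
    Tendsto (fun m : ℕ => minSol p (d * p ^ m) (e * p ^ m) 0) atTop (𝓝 (minSol p 0 0 0)) := by
  obtain ⟨C, hC⟩ := exists_norm_minCoeff_le hp hd ‖e‖
  have hpow := tendsto_pow_atTop_nhds_zero_of_norm_lt_one hp
  have hle : ∀ (x : ℂ) (m : ℕ), ‖x * p ^ m‖ ≤ ‖x‖ := fun x m => by
    rw [norm_mul, norm_pow]
    exact mul_le_of_le_one_right (norm_nonneg _) (pow_le_one₀ (norm_nonneg _) hp.le)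
  have hlim : ∀ x : ℂ, Tendsto (fun m : ℕ => x * p ^ m) atTop (𝓝 0) := fun x => by
    simpa using hpow.const_mul x
  unfold minSol
  simp only [pow_zero, one_pow, mul_one]
  exact tendsto_tsum_of_dominated_convergence
    ((summable_geometric_of_lt_one (norm_nonneg p) hp).mul_left C)
    (fun k => tendsto_minCoeff hp (hlim d) (hlim e) k)
    (Eventually.of_forall fun m k => hC _ _ (hle d m) (hle e m) k)

theorem tendsto_minNum_param {p : ℂ} (hp : ‖p‖ < 1) {d e : ℂ} (hd : ‖d‖ < 1) :
    Tendsto (fun m : ℕ => minNum p (d * p ^ m) (e * p ^ m)) atTop (𝓝 (minSol p 0 0 0)) := by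
  rw [← tendsto_add_atTop_iff_nat 1]
  have hpow := (tendsto_pow_atTop_nhds_zero_of_norm_lt_one hp).comp (tendsto_add_atTop_nat 1)
  have h := ((hpow.const_mul d).const_add 1).mul (tendsto_minSol_param (e := e) hp hd)
  rw [mul_zero, add_zero, one_mul] at h
  refine h.congr fun m => ?_
  have hdm : ‖d * p ^ m‖ < 1 := by
    rw [norm_mul, norm_pow]
    exact (mul_le_of_le_one_right (norm_nonneg _) (pow_le_one₀ (norm_nonneg _) hp.le)).trans_lt hd
  have := one_add_mul_minSol hp hdm (e * p ^ m)
  rwa [mul_assoc d, mul_assoc e, ← pow_succ] at this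

/-- For `d = e = 0` the recurrence is `h n = (1 + p ^ (n + 1)) * h (n + 1)`, so a zero at `0` would
spread to all `n`, against the limit `1`. -/
theorem minSol_zero_ne_zero {p : ℂ} (hp : ‖p‖ < 1) : minSol p 0 0 0 ≠ 0 := by
  intro h0
  have h0' : ‖(0 : ℂ)‖ < 1 := by simp
  have hz : ∀ n, minSol p 0 0 n = 0 := by
    intro n
    induction n with
    | zero => exact h0
    | succ n ih =>
      have hr := minSol_recurrence hp h0' 0 n
      simp only [ih, cfDen, cfNum, sub_zero, one_mul, zero_mul, add_zero] at hr
      refine (mul_eq_zero.1 hr.symm).resolve_left ?_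
      have := one_sub_norm_le_norm_one_add (p ^ (n + 1))
      have hlt : ‖p ^ (n + 1)‖ < 1 := by
        rw [norm_pow]; exact pow_lt_one₀ (norm_nonneg _) hp (by omega)
      exact norm_pos_iff.1 (by linarith)
  have hl := tendsto_minSol hp h0' 0
  rw [show minSol p 0 0 = fun _ => 0 from funext hz] at hl
  exact zero_ne_one (tendsto_nhds_unique tendsto_const_nhds hl)

theorem tendsto_prod_qPochInf (x : ℂ) {q : ℂ} (hq : ‖q‖ < 1) :
    Tendsto (fun n => ∏ k ∈ Finset.range n, (1 - x * q ^ k)) atTop (𝓝 (qPochInf x q)) :=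
  (multipliable_qPochInf x hq).hasProd.tendsto_prod_nat

theorem norm_pow_lt_one {q : ℂ} (hq : ‖q‖ < 1) {n : ℕ} (hn : n ≠ 0) : ‖q ^ n‖ < 1 := by
  rw [norm_pow]
  exact pow_lt_one₀ (norm_nonneg _) hq hn

theorem qPochInf_mul_minNum {a b q : ℂ} (hq : ‖q‖ < 1) (hab : ‖a * b‖ < 1) :
    qPochInf (-(a * b * q ^ 2)) (q ^ 2) * minNum (q ^ 2) (a * b) ((a ^ 2 + b ^ 2) * q) =
      qPochInf (a ^ 2 * q) (q ^ 4) * qPochInf (b ^ 2 * q) (q ^ 4) * minSol (q ^ 2) 0 0 0 := by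
  have hp : ‖q ^ 2‖ < 1 := norm_pow_lt_one hq two_ne_zero
  have hp4 : ‖q ^ 4‖ < 1 := norm_pow_lt_one hq four_ne_zero
  have h2 : Tendsto (fun M : ℕ => 2 * M) atTop atTop :=
    tendsto_atTop_mono (fun n => (by omega : n ≤ 2 * n)) tendsto_id
  have hL := ((tendsto_prod_qPochInf (-(a * b * q ^ 2)) hp).comp h2).mul_const
    (minNum (q ^ 2) (a * b) ((a ^ 2 + b ^ 2) * q))
  have hR := ((tendsto_prod_qPochInf (a ^ 2 * q) hp4).mul
    (tendsto_prod_qPochInf (b ^ 2 * q) hp4)).mul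
      ((tendsto_minNum_param (e := (a ^ 2 + b ^ 2) * q) hp hab).comp h2)
  refine tendsto_nhds_unique hL (hR.congr fun M => ?_)
  have := prod_mul_eq_of_two_step (e := (a ^ 2 + b ^ 2) * q) hp hab
    (fun d e hd => minNum_two_step hp hd e) M
  simp only [Function.comp] at this ⊢
  rw [this, ← Finset.prod_mul_distrib]
  congr 1
  exact Finset.prod_congr rfl fun j _ => by ring

theorem qPochInf_mul_minSol {a b q : ℂ} (hq : ‖q‖ < 1) (hab : ‖a * b‖ < 1) :
    qPochInf (-(a * b * q ^ 2)) (q ^ 2) * minSol (q ^ 2) (a * b) ((a ^ 2 + b ^ 2) * q) 0 =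
      qPochInf (a ^ 2 * q ^ 3) (q ^ 4) * qPochInf (b ^ 2 * q ^ 3) (q ^ 4) *
        minSol (q ^ 2) 0 0 0 := by
  have hp : ‖q ^ 2‖ < 1 := norm_pow_lt_one hq two_ne_zero
  have hp4 : ‖q ^ 4‖ < 1 := norm_pow_lt_one hq four_ne_zero
  have h2 : Tendsto (fun M : ℕ => 2 * M) atTop atTop :=
    tendsto_atTop_mono (fun n => (by omega : n ≤ 2 * n)) tendsto_id
  have hL := ((tendsto_prod_qPochInf (-(a * b * q ^ 2)) hp).comp h2).mul_const
    (minSol (q ^ 2) (a * b) ((a ^ 2 + b ^ 2) * q) 0)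
  have hR := ((tendsto_prod_qPochInf (a ^ 2 * q ^ 3) hp4).mul
    (tendsto_prod_qPochInf (b ^ 2 * q ^ 3) hp4)).mul
      ((tendsto_minSol_param (e := (a ^ 2 + b ^ 2) * q) hp hab).comp h2)
  refine tendsto_nhds_unique hL (hR.congr fun M => ?_)
  have := prod_mul_eq_of_two_step (e := (a ^ 2 + b ^ 2) * q) hp hab
    (Φ := fun d e => minSol (q ^ 2) d e 0) (fun d e hd => minSol_two_step hp hd e) M
  simp only [Function.comp] at this ⊢
  rw [this, ← Finset.prod_mul_distrib]
  congr 1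
  exact Finset.prod_congr rfl fun j _ => by ring

/-! ### The products do not vanish simultaneously -/

theorem exists_of_qPochInf_eq_zero {x q : ℂ} (hq : ‖q‖ < 1) (h : qPochInf x q = 0) :
    ∃ k : ℕ, x * q ^ k = 1 := by
  by_contra! hne
  refine tprod_one_add_ne_zero_of_summable (f := fun k => -(x * q ^ k)) (fun k => ?_) ?_ ?_
  · rw [← sub_eq_add_neg]
    exact sub_ne_zero.2 (hne k).symm
  · simp only [norm_neg, norm_mul, norm_pow]
    exact (summable_geometric_of_lt_one (norm_nonneg q) hq).mul_left ‖x‖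
  · simpa [qPochInf, sub_eq_add_neg] using h

/-- Equality would force equal exponents of `q`, but these are `1` and `3` modulo `4`. -/
theorem ne_one_of_mul_pow_eq_one {x q : ℂ} (hq : ‖q‖ < 1) {i j : ℕ}
    (hi : x * q * (q ^ 4) ^ i = 1) : x * q ^ 3 * (q ^ 4) ^ j ≠ 1 := by
  intro hj
  have hx : x ≠ 0 := by rintro rfl; simp at hi
  have hq0 : q ≠ 0 := by rintro rfl; simp at hi
  have h : x * q ^ (4 * i + 1) = x * q ^ (4 * j + 3) := by
    rw [pow_succ, pow_add, pow_mul, pow_mul]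
    linear_combination hi - hj
  have h1 := congrArg norm (mul_left_cancel₀ hx h)
  rw [norm_pow, norm_pow] at h1
  have := pow_right_injective₀ (norm_pos_iff.2 hq0) hq.ne h1
  omega

/-- The product of the two equations makes `(a * b) ^ 2` times a positive power of `q` equal to `1`,
impossible by size. -/
theorem mul_pow_mul_pow_ne_one {a b q : ℂ} (hq : ‖q‖ < 1) (hab : ‖a * b‖ < 1) {i j : ℕ}
    (hi : a ^ 2 * q * (q ^ 4) ^ i = 1) : b ^ 2 * q ^ 3 * (q ^ 4) ^ j ≠ 1 := by
  intro hj
  have h : (a * b) ^ 2 * q ^ (4 * i + 4 * j + 4) = 1 := by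
    have : (a ^ 2 * q * (q ^ 4) ^ i) * (b ^ 2 * q ^ 3 * (q ^ 4) ^ j) = 1 := by rw [hi, hj, one_mul]
    rw [← this]
    ring
  have h1 := congrArg norm h
  rw [norm_mul, norm_one] at h1
  have h2 := norm_pow_lt_one hab two_ne_zero
  have h3 := norm_pow_lt_one hq (n := 4 * i + 4 * j + 4) (by omega)
  exact (mul_lt_one_of_nonneg_of_lt_one_left (norm_nonneg _) h2 h3.le).ne h1

theorem qPochInf_products_ne_zero {a b q : ℂ} (hq : ‖q‖ < 1) (hab : ‖a * b‖ < 1) :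
    qPochInf (a ^ 2 * q) (q ^ 4) * qPochInf (b ^ 2 * q) (q ^ 4) ≠ 0 ∨
      qPochInf (a ^ 2 * q ^ 3) (q ^ 4) * qPochInf (b ^ 2 * q ^ 3) (q ^ 4) ≠ 0 := by
  have hp4 : ‖q ^ 4‖ < 1 := norm_pow_lt_one hq four_ne_zero
  have hba : ‖b * a‖ < 1 := by rwa [mul_comm]
  by_contra! h
  obtain ⟨h1, h2⟩ := h
  rcases mul_eq_zero.1 h1 with h1 | h1 <;> rcases mul_eq_zero.1 h2 with h2 | h2 <;>
    obtain ⟨i, hi⟩ := exists_of_qPochInf_eq_zero hp4 h1 <;>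
    obtain ⟨j, hj⟩ := exists_of_qPochInf_eq_zero hp4 h2
  · exact ne_one_of_mul_pow_eq_one hq hi hj
  · exact mul_pow_mul_pow_ne_one hq hab hi hj
  · exact mul_pow_mul_pow_ne_one hq hba hi hj
  · exact ne_one_of_mul_pow_eq_one hq hi hj

/-! ### The continued fraction -/

theorem cfConvergesTo_of_norm_mul_lt_one {a b q : ℂ} (hq : ‖q‖ < 1) (hab : ‖a * b‖ < 1) :
    CFConvergesTo (1 - a * b)
      (fun n => (a - b * q ^ (2 * n + 1)) * (b - a * q ^ (2 * n + 1)))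
      (fun n => (1 - a * b) * (1 + q ^ (2 * n + 2)))
      (extDiv
        (qPochInf (a ^ 2 * q) (q ^ 4) * qPochInf (b ^ 2 * q) (q ^ 4))
        (qPochInf (a ^ 2 * q ^ 3) (q ^ 4) * qPochInf (b ^ 2 * q ^ 3) (q ^ 4))) := by
  have hp : ‖q ^ 2‖ < 1 := norm_pow_lt_one hq two_ne_zero
  have hL := minSol_zero_ne_zero hp
  have hF := qPochInf_mul_minNum hq hab
  have hG := qPochInf_mul_minSol hq hab
  have hne := qPochInf_products_ne_zero hq hab
  have hα : (fun n => (a - b * q ^ (2 * n + 1)) * (b - a * q ^ (2 * n + 1))) =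
      cfNum (q ^ 2) (a * b) ((a ^ 2 + b ^ 2) * q) := funext fun n => by
    simp only [cfNum]
    ring
  have hβ : (fun n => (1 - a * b) * (1 + q ^ (2 * n + 2))) = cfDen (q ^ 2) (a * b) :=
    funext fun n => by
      simp only [cfDen]
      ring
  set F := qPochInf (a ^ 2 * q) (q ^ 4) * qPochInf (b ^ 2 * q) (q ^ 4)
  set G := qPochInf (a ^ 2 * q ^ 3) (q ^ 4) * qPochInf (b ^ 2 * q ^ 3) (q ^ 4)
  set P := qPochInf (-(a * b * q ^ 2)) (q ^ 2)
  set L := minSol (q ^ 2) 0 0 0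
  -- If `P` vanished, both `F` and `G` would, contrary to `hne`.
  have hP : P ≠ 0 := by
    rintro h0
    rw [h0, zero_mul, eq_comm, mul_eq_zero] at hF hG
    exact hne.elim (fun h => h (hF.resolve_right hL)) fun h => h (hG.resolve_right hL)
  have hconv := cfConvergesTo_of_solution (1 - a * b) hab
    (tendsto_cfNum hp (a * b) ((a ^ 2 + b ^ 2) * q)) (tendsto_minSol hp hab _)
    (minSol_recurrence hp hab _) ?_
  · rw [hα, hβ, ← extDiv_mul_left hL, mul_comm L, mul_comm L, ← hF, ← hG, extDiv_mul_left hP]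
    exact hconv
  · refine hne.imp (fun h h0 => ?_) fun h h0 => ?_
    · change minNum _ _ _ = 0 at h0
      rw [h0, mul_zero] at hF
      exact mul_ne_zero h hL hF.symm
    · rw [h0, mul_zero] at hG
      exact mul_ne_zero h hL hG.symm

theorem mainTheorem7 (a b q : ℂ) (hq : ‖q‖ < 1) :
    (‖a * b‖ < 1 →
      (qPochInf (a ^ 2 * q) (q ^ 4) * qPochInf (b ^ 2 * q) (q ^ 4) ≠ 0 ∨
        qPochInf (a ^ 2 * q ^ 3) (q ^ 4) * qPochInf (b ^ 2 * q ^ 3) (q ^ 4) ≠ 0) ∧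
      CFConvergesTo (1 - a * b)
        (fun n => (a - b * q ^ (2 * n + 1)) * (b - a * q ^ (2 * n + 1)))
        (fun n => (1 - a * b) * (1 + q ^ (2 * n + 2)))
        (extDiv
          (qPochInf (a ^ 2 * q) (q ^ 4) * qPochInf (b ^ 2 * q) (q ^ 4))
          (qPochInf (a ^ 2 * q ^ 3) (q ^ 4) * qPochInf (b ^ 2 * q ^ 3) (q ^ 4)))) ∧
    (1 < ‖a * b‖ →
      (qPochInf (q / a ^ 2) (q ^ 4) * qPochInf (q / b ^ 2) (q ^ 4) ≠ 0 ∨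
        qPochInf (q ^ 3 / a ^ 2) (q ^ 4) * qPochInf (q ^ 3 / b ^ 2) (q ^ 4) ≠ 0) ∧
      CFConvergesTo (1 - a * b)
        (fun n => (a - b * q ^ (2 * n + 1)) * (b - a * q ^ (2 * n + 1)))
        (fun n => (1 - a * b) * (1 + q ^ (2 * n + 2)))
        (extDiv
          (-(a * b) * (qPochInf (q / a ^ 2) (q ^ 4) * qPochInf (q / b ^ 2) (q ^ 4)))
          (qPochInf (q ^ 3 / a ^ 2) (q ^ 4) * qPochInf (q ^ 3 / b ^ 2) (q ^ 4)))) := by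
  refine ⟨fun hab => ⟨qPochInf_products_ne_zero hq hab,
    cfConvergesTo_of_norm_mul_lt_one hq hab⟩, fun hab => ?_⟩
  have hab0 : a * b ≠ 0 := norm_pos_iff.1 (zero_lt_one.trans hab)
  have ha : a ≠ 0 := left_ne_zero_of_mul hab0
  have hb : b ≠ 0 := right_ne_zero_of_mul hab0
  have hinv : ‖a⁻¹ * b⁻¹‖ < 1 := by
    rw [← mul_inv, norm_inv]
    exact inv_lt_one_of_one_lt₀ hab
  have hne := qPochInf_products_ne_zero hq hinv
  -- With `c = -(a * b)`, multiplying numerators by `c ^ 2` and denominators by `c` turns the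
  -- fraction for `a⁻¹`, `b⁻¹` back into that for `a`, `b`.
  have hconv := (cfConvergesTo_of_norm_mul_lt_one hq hinv).scale (neg_ne_zero.2 hab0)
  have hdiv : ∀ x y : ℂ, y⁻¹ ^ 2 * x = x / y ^ 2 := fun x y => by
    rw [inv_pow, div_eq_mul_inv, mul_comm]
  simp only [hdiv] at hne hconv
  refine ⟨hne, ?_⟩
  convert hconv using 1
  · field_simp
    ring
  · funext n
    field_simp
  · funext n
    field_simp
    ring
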